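/- Let $\mathbb K\in\{\mathbb R,\mathbb C\}$; all Banach spaces are over $\mathbb K$. For $1\le s\le\infty$ let $s^*$ be the conjugate index, $1/s+1/s^*=1$. Definitions. For $1\le p<\infty$ let $\ell_p(X)$ be the space of absolutely $p$-summable sequences in a Banach space $X$, with closed unit ball $B_{\ell_p(X)}$. For $1\le r\le\infty$ let $B_{\ell_r}$ be the closed unit ball of the scalar space $\ell_r$, where $\ell_\infty$ is to be read as $c_0$. For $1\le r\le p^*$ and $(z_k)\in\ell_p(X)$ put $(p,r)\text{-conv}(z_k)=\{\sum_{k} a_kz_k:(a_k)\in B_{\ell_r}\}$. A sequence $(x_n)$ in $X$ is *$(p,r)$-null* if for every $\varepsilon>0$ there are $(z_k)\in\varepsilon B_{\ell_p(X)}$ and $N\in\mathbb N$ with $x_n\in(p,r)\text{-conv}(z_k)$ for all $n\ge N$. For $1\le s\le\infty$ and a sequence $(w_i)$ in a normed space $W$ put $\|(w_i)\|_s^w=\sup\{\|(f(w_i))_i\|_s: f\in W',\ \|f\|\le1\}$, where $\|\cdot\|_\infty$ is the supremum norm. The $(p,1,r^*)$-nuclear quasi-norm of a bounded linear operator $S:E\to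 F$ is $$\nu(S)=\inf\ \|(\sigma_i)\|_p\,\|(a_i)\|_{r}^w\,\|(y_i)\|_{\infty}^w ,$$ the infimum being taken over all representations $S=\sum_i\sigma_i\,a_i(\cdot)\,y_i$ with $\sigma_i\in\mathbb K$, $a_i\in E'$, $y_i\in F$ and all three factors finite ($\nu(S)=\infty$ if there are none). The ideal $\mathcal I_{(p,1,r^*)}$ of *$(p,1,r^*)$-integral operators* is the maximal hull of the ideal of $(p,1,r^*)$-nuclear operators: a bounded linear operator $S:E\to F$ between Banach spaces belongs to it if and only if $\sup\nu(BSA)<\infty$, the supremum being taken over all finite-dimensional normed spaces $E_0,F_0$ and all linear $A:E_0\to E$, $B:F\to F_0$ with $\|A\|\le1$, $\|B\|\le1$. Let $\mathcal A$ be a class of bounded linear operators between Banach spaces, with components $\mathcal A(Y,X)$. Its surjective hull $\mathcal A^{\mathrm{sur}}$ consists of the bounded linear operators $T:Y\to X$ such that $Tq\in\mathcal A(Z,X)$ for some Banach space $Z$ and some bounded linear surjection $q:Z\to Y$. A sequence $(x_n)$ in $X$ is *$\mathcal A$-null* if there are a Banach space $Y$, a norm-null sequence $(y_n)$ in $Y$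 and $T\in\mathcal A(Y,X)$ with $x_n=Ty_n$ for all $n$. A subset $K$ of $X$ is *$\mathcal A$-compact* if $K\subset T(F)$ for some Banach space $Y$, some relatively compact $F\subset Y$ and some $T\in\mathcal A(Y,X)$; a sequence is $\mathcal A$-compact if its set of terms is. Proposition 3.3. Let $1\le p<\infty$ and $1\le r\le p^*$. For a sequence $(x_n)$ in a Banach space $X$ the following statements are equivalent: (a) $(x_n)$ is $(p,r)$-null; (b) $(x_n)$ converges to $0$ in norm and is $\mathcal I_{(p,1,r^*)}^{\mathrm{sur}}$-compact; (c) $(x_n)$ is $\mathcal I_{(p,1,r^*)}^{\mathrm{sur}}$-null. -/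

import Mathlib

open Filter Topology MeasureTheory ENNReal

universe u

namespace PRNull

/-- The `ℓ_s`-norm of a sequence, with values in `[0, ∞]`: the `L_s`-norm for the counting measure,
i.e. `(∑ ‖x i‖ ^ s) ^ (1 / s)` for `0 < s < ∞` and `sup ‖x i‖` for `s = ∞`.
The sequence belongs to `ℓ_s(E)` iff this is finite. -/
noncomputable def seqNorm {E : Type*} [NormedAddCommGroup E] (s : ℝ≥0∞) (x : ℕ → E) : ℝ≥0∞ :=
  eLpNorm x s Measure.count

/-- The weak `ℓ_s`-norm of a sequence, with values in `[0, ∞]`: the supremum of the `ℓ_s`-norms of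
`(f (x i))`, where `f` runs through the closed unit ball of the dual space. -/
noncomputable def weakSeqNorm (𝕜 : Type) [RCLike 𝕜] {E : Type*} [NormedAddCommGroup E]
    [NormedSpace 𝕜 E] (s : ℝ≥0∞) (x : ℕ → E) : ℝ≥0∞ :=
  ⨆ (f : StrongDual 𝕜 E) (_ : ‖f‖ ≤ 1), seqNorm s (fun i => f (x i))

/-! ### `(p, r)`-null sequences -/

/-- The `(p, r)`-convex hull `{∑ a k • z k : (a k) ∈ B_{ℓ_r}}` of a sequence, with the convention
that `ℓ_r` is `c₀` for `r = ∞`. -/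
def prConv (𝕜 : Type) [RCLike 𝕜] {X : Type*} [NormedAddCommGroup X] [NormedSpace 𝕜 X]
    (r : ℝ≥0∞) (z : ℕ → X) : Set X :=
  {x | ∃ a : ℕ → 𝕜, seqNorm r a ≤ 1 ∧ (r = ∞ → Tendsto a atTop (𝓝 0)) ∧
    HasSum (fun k => a k • z k) x}

/-- `(p, r)`-null sequences, for `p < ∞`: for each `ε > 0` there are a sequence `z` in `ε B_{ℓ_p(X)}`
and an `N` such that `x n` lies in the `(p, r)`-convex hull of `z` for all `n ≥ N`. -/
def IsPRNull (𝕜 : Type) [RCLike 𝕜] {X : Type*} [NormedAddCommGroup X] [NormedSpace 𝕜 X]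
    (p r : ℝ≥0∞) (x : ℕ → X) : Prop :=
  ∀ ε : ℝ, 0 < ε → ∃ z : ℕ → X, seqNorm p z ≤ ENNReal.ofReal ε ∧
    ∃ N : ℕ, ∀ n ≥ N, x n ∈ prConv 𝕜 r z

/-! ### Classes of operators, null sequences and compact sets with respect to them -/

/-- A class of bounded linear operators between arbitrary Banach spaces over `𝕜`. -/
abbrev OperatorClass (𝕜 : Type) [RCLike 𝕜] : Type (u + 1) :=
  ∀ (Y X : Type u) [NormedAddCommGroup Y] [NormedSpace 𝕜 Y] [CompleteSpace Y]
    [NormedAddCommGroup X] [NormedSpace 𝕜 X] [CompleteSpace X], Set (Y →L[𝕜] X)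

/-- The surjective hull: `T : Y → X` belongs to it iff `T ∘ q` is in the class for some bounded
linear surjection `q` of a Banach space `Z` onto `Y`. -/
def surHull {𝕜 : Type} [RCLike 𝕜] (A : OperatorClass.{u} 𝕜) : OperatorClass.{u} 𝕜 :=
  fun Y X _ _ _ _ _ _ =>
    {T | ∃ (Z : Type u) (_ : NormedAddCommGroup Z) (_ : NormedSpace 𝕜 Z) (_ : CompleteSpace Z)
      (q : Z →L[𝕜] Y), Function.Surjective q ∧ T.comp q ∈ A Z X}

/-- `A`-null sequences: `x n = T (y n)` for a null sequence `y` in some Banach space `Y` and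
some `T` in `A(Y, X)`. -/
def IsOpNull {𝕜 : Type} [RCLike 𝕜] (A : OperatorClass.{u} 𝕜) {X : Type u} [NormedAddCommGroup X]
    [NormedSpace 𝕜 X] [CompleteSpace X] (x : ℕ → X) : Prop :=
  ∃ (Y : Type u) (_ : NormedAddCommGroup Y) (_ : NormedSpace 𝕜 Y) (_ : CompleteSpace Y)
    (y : ℕ → Y) (T : Y →L[𝕜] X),
    Tendsto y atTop (𝓝 0) ∧ T ∈ A Y X ∧ ∀ n, x n = T (y n)

/-- `A`-compact sets: `K ⊆ T(F)` for a relatively compact subset `F` of some Banach space `Y` and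
some `T` in `A(Y, X)`. -/
def IsOpCompact {𝕜 : Type} [RCLike 𝕜] (A : OperatorClass.{u} 𝕜) {X : Type u}
    [NormedAddCommGroup X] [NormedSpace 𝕜 X] [CompleteSpace X] (K : Set X) : Prop :=
  ∃ (Y : Type u) (_ : NormedAddCommGroup Y) (_ : NormedSpace 𝕜 Y) (_ : CompleteSpace Y)
    (F : Set Y) (T : Y →L[𝕜] X),
    IsCompact (closure F) ∧ T ∈ A Y X ∧ K ⊆ T '' F

/-! ### `(t, u, v)`-nuclear and `(t, u, v)`-integral operators -/

/-- `S = ∑ σ i • (a i ⊗ y i)` is a `(t, u, v)`-nuclear representation of the operator `S : E → F`: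
`(σ i) ∈ ℓ_t` (`c₀` for `t = ∞`), `(a i)` is a weakly `v*`-summable sequence in the dual of `E`, and
`(y i)` is a weakly `u*`-summable sequence in `F` (bounded sequences if the exponent is `∞`). Under
the standing condition `1 + 1/t ≥ 1/u + 1/v` such a series converges unconditionally in the operator
norm by Hölder's inequality, so it is enough to identify its sum pointwise. -/
structure IsNuclearRep {𝕜 : Type} [RCLike 𝕜] {E F : Type*} [NormedAddCommGroup E]
    [NormedSpace 𝕜 E] [NormedAddCommGroup F] [NormedSpace 𝕜 F] (t u v : ℝ≥0∞) (S : E →L[𝕜] F)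
    (σ : ℕ → 𝕜) (a : ℕ → StrongDual 𝕜 E) (y : ℕ → F) : Prop where
  scalar_lt_top : seqNorm t σ < ∞
  scalar_null : t = ∞ → Tendsto σ atTop (𝓝 0)
  dual_lt_top : weakSeqNorm 𝕜 (conjExponent v) a < ∞
  vector_lt_top : weakSeqNorm 𝕜 (conjExponent u) y < ∞
  hasSum : ∀ e : E, HasSum (fun i => (σ i * a i e) • y i) (S e)

/-- The quasi-norm of the ideal of `(t, u, v)`-nuclear operators: the infimum of
`‖(σ i)‖_t * w_{v*}((a i)) * w_{u*}((y i))` over all `(t, u, v)`-nuclear representations of `S`. It is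
`∞` iff `S` is not `(t, u, v)`-nuclear. -/
noncomputable def nuclearNorm {𝕜 : Type} [RCLike 𝕜] {E F : Type*} [NormedAddCommGroup E]
    [NormedSpace 𝕜 E] [NormedAddCommGroup F] [NormedSpace 𝕜 F] (t u v : ℝ≥0∞)
    (S : E →L[𝕜] F) : ℝ≥0∞ :=
  ⨅ (σ : ℕ → 𝕜) (a : ℕ → StrongDual 𝕜 E) (y : ℕ → F) (_ : IsNuclearRep t u v S σ a y),
    seqNorm t σ * weakSeqNorm 𝕜 (conjExponent v) a * weakSeqNorm 𝕜 (conjExponent u) y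

/-- The `(t, u, v)`-integral operators: the maximal hull of the quasi-normed ideal of
`(t, u, v)`-nuclear operators. An operator `S : E → F` belongs to it iff the nuclear quasi-norms of
`B ∘ S ∘ A`, where `A : E₀ → E` and `B : F → F₀` have norm at most one and `E₀`, `F₀` are
finite-dimensional normed spaces, are bounded. -/
def integralOperators (𝕜 : Type) [RCLike 𝕜] (t u v : ℝ≥0∞) : OperatorClass.{u} 𝕜 :=
  fun E F _ _ _ _ _ _ =>
    {S | ∃ ρ : ℝ≥0∞, ρ < ∞ ∧
      ∀ (E₀ F₀ : Type u) [NormedAddCommGroup E₀] [NormedSpace 𝕜 E₀] [FiniteDimensional 𝕜 E₀]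
        [NormedAddCommGroup F₀] [NormedSpace 𝕜 F₀] [FiniteDimensional 𝕜 F₀]
        (A : E₀ →L[𝕜] E) (B : F →L[𝕜] F₀), ‖A‖ ≤ 1 → ‖B‖ ≤ 1 →
        nuclearNorm t u v (B.comp (S.comp A)) ≤ ρ}

end PRNull

/-! The model operator is `a ↦ ∑ a k • z k` on `ℓ_r` with `z` in `ℓ_p(X)`. It converges absolutely
by Hölder, since `r ≤ p*`, and it is integral: `σ k = ‖z k‖`, the coordinate functionals and the
normalized vectors represent all its finite-dimensional pieces. Given a `(p, r)`-null sequence, the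
witnesses for `ε = 4⁻ᵐ`, rescaled by `2ᵐ`, glue to one such `z`, and the terms become images of a
null sequence (`isOpNull_of_isPRNull`).

The converse must extract global information from an operator `S` known only through its
compressions to finite-dimensional spaces. The key is `exists_finite_rep_of_integral`: finitely many
images `S (w j)` of points of the unit ball are combinations of one finite family, with bounds
independent of the number of points. In each finite-dimensional quotient of `X` such combinations
come from nuclearity, but with coefficients depending on the quotient.
`exists_finite_discretization` merges terms whose coefficient vectors point in nearly the same
direction and rounds the weights, so only finitely many coefficient systems remain. If none of these
worked in `X` itself, Hahn-Banach would give one functional per system; together they define a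
single finite-dimensional quotient in which all fail (`exists_approx_of_quotients`). Applied to
successive blocks of a null sequence, this gives `(p, r)`-nullness.

The surjective hull costs nothing for null sequences, as these lift through surjections by the open
mapping theorem. It is what allows passing to the quotient by the kernel of `T`, where `T` becomes
injective and hence reflects convergence on compact sets; so compactness and norm convergence give
nullness. -/

namespace PRNull

/-! ### `ℓ_s`-norms of families of extended nonnegative numbers -/

/-- The `ℓ_s`-norm of a family of extended nonnegative numbers over an arbitrary index type. -/
noncomputable def countNorm {ι : Type*} (s : ℝ≥0∞) (f : ι → ℝ≥0∞) : ℝ≥0∞ :=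
  letI : MeasurableSpace ι := ⊤
  eLpNorm f s Measure.count

section countNorm

variable {ι κ : Type*} {s : ℝ≥0∞} {f g : ι → ℝ≥0∞}

theorem countNorm_top (f : ι → ℝ≥0∞) : countNorm ∞ f = ⨆ i, f i := by
  let _ : MeasurableSpace ι := ⊤
  simp [countNorm, eLpNormEssSup]

theorem countNorm_eq_tsum (h0 : s ≠ 0) (ht : s ≠ ∞) (f : ι → ℝ≥0∞) :
    countNorm s f = (∑' i, f i ^ s.toReal) ^ (1 / s.toReal) := by
  let _ : MeasurableSpace ι := ⊤
  rw [countNorm, eLpNorm_eq_lintegral_rpow_enorm_toReal h0 ht, lintegral_count]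
  simp

theorem countNorm_rpow (h0 : s ≠ 0) (ht : s ≠ ∞) (f : ι → ℝ≥0∞) :
    countNorm s f ^ s.toReal = ∑' i, f i ^ s.toReal := by
  rw [countNorm_eq_tsum h0 ht, ← ENNReal.rpow_mul, one_div,
    inv_mul_cancel₀ (ENNReal.toReal_pos h0 ht).ne', ENNReal.rpow_one]

theorem countNorm_one (f : ι → ℝ≥0∞) : countNorm 1 f = ∑' i, f i := by
  simp [countNorm_eq_tsum one_ne_zero one_ne_top]

theorem countNorm_mono (h : ∀ i, f i ≤ g i) : countNorm s f ≤ countNorm s g := by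
  let _ : MeasurableSpace ι := ⊤
  exact eLpNorm_mono_enorm (by simpa using h)

theorem countNorm_add_le (hs : 1 ≤ s) :
    countNorm s (fun i => f i + g i) ≤ countNorm s f + countNorm s g := by
  let _ : MeasurableSpace ι := ⊤
  exact eLpNorm_add_le measurable_from_top.aestronglyMeasurable
    measurable_from_top.aestronglyMeasurable hs

theorem countNorm_const_mul (h0 : s ≠ 0) (c : ℝ≥0∞) (f : ι → ℝ≥0∞) :
    countNorm s (fun i => c * f i) = c * countNorm s f := by
  rcases eq_or_ne s ∞ with rfl | ht
  · simp only [countNorm_top, ENNReal.mul_iSup]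
  · have hs := ENNReal.toReal_pos h0 ht
    simp only [countNorm_eq_tsum h0 ht, ENNReal.mul_rpow_of_nonneg _ _ hs.le, ENNReal.tsum_mul_left]
    rw [ENNReal.mul_rpow_of_nonneg _ _ (by positivity), ← ENNReal.rpow_mul, mul_one_div,
      div_self hs.ne', ENNReal.rpow_one]

theorem le_countNorm (h0 : s ≠ 0) (f : ι → ℝ≥0∞) (i : ι) : f i ≤ countNorm s f := by
  rcases eq_or_ne s ∞ with rfl | ht
  · rw [countNorm_top]
    exact le_iSup f i
  · have hs := ENNReal.toReal_pos h0 ht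
    rw [← ENNReal.rpow_le_rpow_iff hs, countNorm_rpow h0 ht]
    exact ENNReal.le_tsum (f := fun j => f j ^ s.toReal) i

theorem countNorm_anti {t : ℝ≥0∞} (h0 : s ≠ 0) (hst : s ≤ t) (f : ι → ℝ≥0∞) :
    countNorm t f ≤ countNorm s f := by
  rcases eq_or_ne t ∞ with rfl | ht
  · rw [countNorm_top]
    exact iSup_le (le_countNorm h0 f)
  have hs : s ≠ ∞ := ne_top_of_le_ne_top ht hst
  have ht0 : t ≠ 0 := (h0.bot_lt.trans_le hst).ne'
  have hs' := ENNReal.toReal_pos h0 hs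
  have ht' := ENNReal.toReal_pos ht0 ht
  have hle : s.toReal ≤ t.toReal := ENNReal.toReal_mono ht hst
  -- One factor `c ^ s` is kept for the sum; the remaining power is bounded through `f i ≤ countNorm
  -- s f`.
  have split : ∀ c : ℝ≥0∞, c ^ t.toReal = c ^ s.toReal * c ^ (t.toReal - s.toReal) := fun c => by
    rw [← ENNReal.rpow_add_of_nonneg _ _ hs'.le (sub_nonneg.2 hle), add_sub_cancel]
  rw [← ENNReal.rpow_le_rpow_iff ht', countNorm_rpow ht0 ht, split (countNorm s f),
    countNorm_rpow h0 hs, ← ENNReal.tsum_mul_right]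
  refine ENNReal.tsum_le_tsum fun i => ?_
  rw [split]
  gcongr
  exact le_countNorm h0 f i

theorem tsum_mul_le_countNorm {t : ℝ≥0∞} (hst : s.HolderConjugate t) (f g : ι → ℝ≥0∞) :
    ∑' i, f i * g i ≤ countNorm s f * countNorm t g := by
  let _ : MeasurableSpace ι := ⊤
  rcases eq_or_ne s ∞ with rfl | hs
  · obtain rfl : t = 1 := hst.conjExponent_eq.symm.trans (by simp [ENNReal.conjExponent])
    rw [countNorm_one, ← ENNReal.tsum_mul_left]
    gcongr with i
    exact le_countNorm top_ne_zero f i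
  rcases eq_or_ne t ∞ with rfl | ht
  · obtain rfl : s = 1 := hst.symm.conjExponent_eq.symm.trans (by simp [ENNReal.conjExponent])
    rw [countNorm_one, ← ENNReal.tsum_mul_right]
    gcongr with i
    exact le_countNorm top_ne_zero g i
  have h := HolderConjugate.toReal_of_ne_top hs ht
  rw [countNorm_eq_tsum (HolderConjugate.ne_zero s t) hs,
    countNorm_eq_tsum (HolderConjugate.ne_zero t s) ht]
  simpa [lintegral_count] using ENNReal.lintegral_mul_le_Lp_mul_Lq Measure.count h
    (f := f) (g := g) measurable_from_top.aemeasurable measurable_from_top.aemeasurable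

/-- Hölder's inequality for `1 / p + 1 / r ≥ 1`. -/
theorem tsum_mul_le_of_le_conjExponent {p r : ℝ≥0∞} (hp : 1 ≤ p) (hr : 1 ≤ r)
    (hrp : r ≤ p.conjExponent) (f g : ι → ℝ≥0∞) :
    ∑' i, f i * g i ≤ countNorm r f * countNorm p g :=
  (tsum_mul_le_countNorm (HolderConjugate.conjExponent hp).symm f g).trans <| by
    gcongr
    exact countNorm_anti (one_pos.trans_le hr).ne' hrp f

/-- Used to cut a sequence into pieces by direction at no cost in norm. -/
theorem countNorm_fiberwise (h0 : s ≠ 0) (f : ι → ℝ≥0∞) (b : ι → κ) [DecidableEq κ] :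
    countNorm s (fun j => countNorm s fun i => if b i = j then f i else 0) = countNorm s f := by
  rcases eq_or_ne s ∞ with rfl | ht
  · simp only [countNorm_top]
    rw [iSup_comm]
    refine iSup_congr fun i => le_antisymm (iSup_le fun j => ?_) (le_iSup_of_le (b i) (by simp))
    split_ifs <;> simp
  · rw [countNorm_eq_tsum h0 ht, countNorm_eq_tsum h0 ht]
    simp only [countNorm_rpow h0 ht]
    rw [ENNReal.tsum_comm]
    congr 2 with i
    rw [tsum_eq_single (b i) fun j hj => by
      rw [if_neg hj.symm, ENNReal.zero_rpow_of_pos (ENNReal.toReal_pos h0 ht)], if_pos rfl]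

theorem countNorm_extend (h0 : s ≠ 0) {e : ι → κ} (he : e.Injective) (f : ι → ℝ≥0∞) :
    countNorm s (Function.extend e f 0) = countNorm s f := by
  rcases eq_or_ne s ∞ with rfl | ht
  · simp only [countNorm_top]
    refine le_antisymm (iSup_le fun j => ?_) (iSup_le fun i => ?_)
    · by_cases h : ∃ i, e i = j
      · obtain ⟨i, rfl⟩ := h
        rw [he.extend_apply]
        exact le_iSup f i
      · rw [Function.extend_apply' _ _ _ h]
        exact zero_le
    · exact le_iSup_of_le (e i) (by rw [he.extend_apply])
  · rw [countNorm_eq_tsum h0 ht, countNorm_eq_tsum h0 ht, ← tsum_extend_zero he]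
    congr 2 with j
    by_cases h : ∃ i, e i = j
    · obtain ⟨i, rfl⟩ := h
      simp [he.extend_apply]
    · simp [Function.extend_apply' _ _ _ h, ENNReal.toReal_pos h0 ht]

theorem countNorm_sigma {β : κ → Type*} (h0 : s ≠ 0) (f : (Σ j, β j) → ℝ≥0∞) :
    countNorm s f = countNorm s fun j => countNorm s fun i => f ⟨j, i⟩ := by
  rcases eq_or_ne s ∞ with rfl | ht
  · simp only [countNorm_top, iSup_sigma]
  · simp only [countNorm_eq_tsum h0 ht _, ENNReal.tsum_sigma']
    simp only [← countNorm_eq_tsum h0 ht, countNorm_rpow h0 ht]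

theorem countNorm_sum_elim_le (hs : 1 ≤ s) (f : ι → ℝ≥0∞) (g : κ → ℝ≥0∞) :
    countNorm s (Sum.elim f g) ≤ countNorm s f + countNorm s g := by
  have h0 : s ≠ 0 := (one_pos.trans_le hs).ne'
  have hf := countNorm_extend h0 (Sum.inl_injective (α := ι) (β := κ)) f
  have hg := countNorm_extend h0 (Sum.inr_injective (α := ι) (β := κ)) g
  rw [← hf, ← hg]
  refine (countNorm_mono fun i => ?_).trans (countNorm_add_le hs)
  rcases i with i | i
  · rw [Sum.inl_injective.extend_apply]
    exact le_self_add
  · rw [Sum.inr_injective.extend_apply]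
    exact le_add_self

theorem countNorm_le_tsum (hs : 1 ≤ s) (f : ι → ℝ≥0∞) : countNorm s f ≤ ∑' i, f i :=
  (countNorm_anti one_ne_zero hs f).trans (countNorm_one f).le

end countNorm

theorem seqNorm_eq_countNorm {E : Type*} [NormedAddCommGroup E] (s : ℝ≥0∞) (x : ℕ → E) :
    seqNorm s x = countNorm s fun i => ‖x i‖ₑ :=
  (eLpNorm_enorm x).symm

/-! ### Discretization of `(p, r)`-convex combinations -/

theorem countNorm_finset_sum_le {ι κ : Type*} {s : ℝ≥0∞} (hs : 1 ≤ s) (t : Finset κ)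
    (f : κ → ι → ℝ≥0∞) :
    countNorm s (fun i => ∑ j ∈ t, f j i) ≤ ∑ j ∈ t, countNorm s (f j) := by
  classical
  induction t using Finset.induction_on with
  | empty =>
    simpa using (countNorm_le_tsum hs fun _ : ι => (0 : ℝ≥0∞))
  | insert j t hj ih =>
    simp only [Finset.sum_insert hj]
    exact (countNorm_add_le hs).trans (add_le_add le_rfl ih)

variable {𝕜 : Type} [RCLike 𝕜]

/-- A finite set of vectors in the unit ball that contains all directions up to an error `ε`. -/
theorem exists_finset_directions (V : Type*) [NormedAddCommGroup V] [NormedSpace 𝕜 V]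
    [FiniteDimensional 𝕜 V] {ε : ℝ} (hε : 0 < ε) :
    ∃ U : Finset V, (∀ u ∈ U, ‖u‖ ≤ 1) ∧
      ∀ v : V, ∃ u ∈ U, ‖v - (‖v‖ : 𝕜) • u‖ ≤ ε * ‖v‖ := by
  have := FiniteDimensional.proper_rclike 𝕜 V
  obtain ⟨t, ht, hfin, hcov⟩ :=
    (isCompact_closedBall (0 : V) 1).finite_cover_balls hε
  refine ⟨hfin.toFinset, fun u hu => by simpa using ht (hfin.mem_toFinset.1 hu), fun v => ?_⟩
  have hmem : ((‖v‖ : 𝕜)⁻¹ • v) ∈ Metric.closedBall (0 : V) 1 := by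
    simp only [mem_closedBall_zero_iff, norm_smul, norm_inv, RCLike.norm_ofReal, abs_norm]
    exact inv_mul_le_one
  obtain ⟨u, hu, hvu⟩ := Set.mem_iUnion₂.1 (hcov hmem)
  refine ⟨u, hfin.mem_toFinset.2 hu, ?_⟩
  rcases eq_or_ne v 0 with rfl | hv
  · simp
  have hv' : (‖v‖ : 𝕜) ≠ 0 := by simpa using hv
  have : v - (‖v‖ : 𝕜) • u = (‖v‖ : 𝕜) • ((‖v‖ : 𝕜)⁻¹ • v - u) := by
    rw [smul_sub, smul_inv_smul₀ hv']
  rw [this, norm_smul, RCLike.norm_ofReal, abs_norm, mul_comm]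
  gcongr
  exact (mem_ball_iff_norm.1 hvu).le

theorem summable_smul_of_countNorm {p r : ℝ≥0∞} (hp : 1 ≤ p) (hr : 1 ≤ r)
    (hrp : r ≤ p.conjExponent) {ι F : Type*} [NormedAddCommGroup F] [NormedSpace 𝕜 F]
    [CompleteSpace F] {a : ι → 𝕜} {z : ι → F} (ha : countNorm r (fun k => ‖a k‖ₑ) ≠ ∞)
    (hz : countNorm p (fun k => ‖z k‖ₑ) ≠ ∞) : Summable fun k => a k • z k := by
  refine Summable.of_enorm (ne_top_of_le_ne_top (ENNReal.mul_ne_top ha hz) ?_)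
  simpa only [enorm_smul] using tsum_mul_le_of_le_conjExponent hp hr hrp _ _

theorem enorm_tsum_smul_le {p r : ℝ≥0∞} (hp : 1 ≤ p) (hr : 1 ≤ r)
    (hrp : r ≤ p.conjExponent) {ι F : Type*} [NormedAddCommGroup F] [NormedSpace 𝕜 F]
    (a : ι → 𝕜) (z : ι → F) :
    ‖∑' k, a k • z k‖ₑ ≤ countNorm r (fun k => ‖a k‖ₑ) * countNorm p (fun k => ‖z k‖ₑ) := by
  refine enorm_tsum_le_tsum_enorm.trans ?_
  simpa only [enorm_smul] using tsum_mul_le_of_le_conjExponent hp hr hrp _ _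

/-- Finitely many `(p, r)`-convex combinations of one sequence in a Banach space are, up to a small
error, `(p, r)`-convex combinations of finitely many vectors, with coefficients from a finite set
that depends neither on the space nor on the sequence. -/
theorem exists_finite_discretization {p r : ℝ≥0∞} (hp : 1 ≤ p) (hr : 1 ≤ r)
    (hrp : r ≤ p.conjExponent) (J : Type) [Fintype J] (R : NNReal) {ε : ℝ} (hε : 0 < ε) :
    ∃ (ι Λ : Type) (_ : Fintype ι) (_ : Fintype Λ) (α : Λ → ι → J → 𝕜),
      ∀ (F : Type u) [NormedAddCommGroup F] [NormedSpace 𝕜 F] [CompleteSpace F]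
        (a : J → ℕ → 𝕜) (z : ℕ → F) (x : J → F),
        (∀ j, countNorm r (fun k => ‖a j k‖ₑ) ≤ 1) → countNorm p (fun k => ‖z k‖ₑ) ≤ R →
        (∀ j, HasSum (fun k => a j k • z k) (x j)) →
        ∃ l, (∀ j, countNorm r (fun i => ‖α l i j‖ₑ) ≤ 3) ∧
          ∃ z' : ι → F, countNorm p (fun i => ‖z' i‖ₑ) ≤ R ∧
            ∀ j, ‖x j - ∑ i, α l i j • z' i‖ ≤ ε := by
  classical
  have hp0 : p ≠ 0 := (one_pos.trans_le hp).ne'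
  have hr0 : r ≠ 0 := (one_pos.trans_le hr).ne'
  set c : ℕ := Fintype.card J
  -- Small enough that `δ * c ≤ 1`, which bounds the new coefficients, and `δ * (c * R) ≤ ε`, which
  -- bounds the error.
  set δ : ℝ := min 1 ε / ((c + 1) * (R + 1)) with hδ
  have hR : (0 : ℝ) ≤ R := R.2
  have hmin : 0 < min 1 ε := lt_min one_pos hε
  have hδ0 : 0 < δ := by positivity
  have hδ1 : δ * c ≤ 1 := by
    rw [hδ, div_mul_eq_mul_div, div_le_one (by positivity)]
    have := min_le_left 1 ε
    have hc : (0 : ℝ) ≤ c := by positivity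
    nlinarith [mul_nonneg hc hR]
  have hδ2 : δ * (c * R) ≤ ε := by
    rw [hδ, div_mul_eq_mul_div, div_le_iff₀ (by positivity)]
    have hc : (0 : ℝ) ≤ c := by positivity
    exact mul_le_mul (min_le_right 1 ε) (by nlinarith) (by positivity) hε.le
  obtain ⟨U, hU1, hU⟩ := exists_finset_directions (𝕜 := 𝕜) (J → 𝕜) hδ0
  choose g hgU hg using hU
  -- The mesh for rounding weights: all roundings together add at most `U.card * η ≤ 1` to a
  -- coefficient norm.
  set η : ℝ := 1 / (U.card + 1) with hη
  have hη0 : 0 < η := by positivity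
  set L : ℕ := ⌊(c : ℝ) / η⌋₊
  -- One merged vector per direction; a system is a choice of weight levels. The `+ 1` rounds
  -- weights up and keeps them positive.
  refine ⟨U, U → Fin (L + 1), inferInstance, inferInstance,
    fun l u j => ((η * ((l u : ℕ) + 1) : ℝ) : 𝕜) * (u : J → 𝕜) j, ?_⟩
  intro F _ _ _ a z x ha hz hx
  set t : ℕ → J → 𝕜 := fun k j => a j k with ht
  let b : ℕ → U := fun k => ⟨g (t k), hgU _⟩
  have hb : ∀ k, ‖t k - (‖t k‖ : 𝕜) • (b k : J → 𝕜)‖ ≤ δ * ‖t k‖ := fun k => hg (t k)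
  have hbj : ∀ k j, ‖a j k - (‖t k‖ : 𝕜) * (b k : J → 𝕜) j‖ₑ ≤ ENNReal.ofReal δ * ‖t k‖ₑ := by
    intro k j
    rw [← ofReal_norm, ← ofReal_norm, ← ENNReal.ofReal_mul hδ0.le]
    exact ENNReal.ofReal_le_ofReal ((norm_le_pi_norm (t k - (‖t k‖ : 𝕜) • (b k : J → 𝕜)) j).trans
      (hb k))
  have htN : countNorm r (fun k => ‖t k‖ₑ) ≤ c := by
    refine (countNorm_mono fun k => ?_).trans
      ((countNorm_finset_sum_le hr Finset.univ fun j k => ‖a j k‖ₑ).trans ?_)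
    · have h : ‖t k‖ ≤ ∑ j, ‖a j k‖ :=
        (pi_norm_le_iff_of_nonneg (Finset.sum_nonneg fun j _ => norm_nonneg (a j k))).2 fun j =>
          Finset.single_le_sum (f := fun j => ‖a j k‖) (fun j _ => norm_nonneg _)
            (Finset.mem_univ j)
      rw [← ofReal_norm]
      refine (ENNReal.ofReal_le_ofReal h).trans ?_
      rw [ENNReal.ofReal_sum_of_nonneg fun j _ => norm_nonneg _]
      simp [ofReal_norm]
    · refine (Finset.sum_le_sum fun j _ => ha j).trans ?_
      simp [c]
  let τ : U → ℕ → 𝕜 := fun u k => if b k = u then (‖t k‖ : 𝕜) else 0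
  let ω : U → ℕ → F := fun u k => if b k = u then z k else 0
  let T : U → ℝ≥0∞ := fun u => countNorm r fun k => if b k = u then ‖t k‖ₑ else 0
  let P : U → ℝ≥0∞ := fun u => countNorm p fun k => if b k = u then ‖z k‖ₑ else 0
  have hτT : ∀ u, countNorm r (fun k => ‖τ u k‖ₑ) = T u := fun u => by
    congr 1 with k
    simp only [τ]
    split_ifs
    · rw [← ofReal_norm, RCLike.norm_ofReal, abs_norm, ofReal_norm]
    · simp
  have hωP : ∀ u, countNorm p (fun k => ‖ω u k‖ₑ) = P u := fun u => by
    congr 1 with k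
    simp only [ω]
    split_ifs <;> simp
  have hPR : countNorm p P ≤ R := by
    rw [countNorm_fiberwise hp0 (fun k => ‖z k‖ₑ) b]
    exact hz
  have hTc : ∀ u, T u ≤ c := fun u =>
    (countNorm_mono fun k => by split_ifs <;> simp).trans htN
  have hT : ∀ u, T u ≠ ∞ := fun u => ne_top_of_le_ne_top (natCast_ne_top c) (hTc u)
  have hP : ∀ u, P u ≠ ∞ := fun u =>
    ne_top_of_le_ne_top coe_ne_top ((le_countNorm hp0 P u).trans hPR)
  have hTr : ∀ u, (T u).toReal ≤ c := fun u => by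
    simpa using ENNReal.toReal_mono (natCast_ne_top c) (hTc u)
  let l : U → Fin (L + 1) := fun u => ⟨⌊(T u).toReal / η⌋₊, Nat.lt_succ_of_le
    (Nat.floor_le_floor (div_le_div_of_nonneg_right (hTr u) hη0.le))⟩
  let w : U → ℝ := fun u => η * ((l u : ℕ) + 1)
  have hw0 : ∀ u, 0 < w u := fun u => by positivity
  have hTw : ∀ u, T u ≤ ENNReal.ofReal (w u) := fun u => by
    rw [ENNReal.le_ofReal_iff_toReal_le (hT u) (hw0 u).le, ← div_le_iff₀' hη0]
    exact (Nat.lt_floor_add_one _).le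
  have hwT : ∀ u, ENNReal.ofReal (w u) ≤ T u + ENNReal.ofReal η := fun u => by
    rw [← ENNReal.ofReal_toReal (hT u), ← ENNReal.ofReal_add ENNReal.toReal_nonneg hη0.le]
    refine ENNReal.ofReal_le_ofReal ?_
    simp only [w, mul_add, mul_one]
    gcongr
    rw [← le_div_iff₀' hη0]
    exact Nat.floor_le (by positivity)
  have hwk : ∀ u, ((w u : ℝ) : 𝕜) ≠ 0 := fun u => RCLike.ofReal_ne_zero.2 (hw0 u).ne'
  have hwe : ∀ u, ‖((w u : ℝ) : 𝕜)‖ₑ = ENNReal.ofReal (w u) := fun u => by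
    rw [← ofReal_norm, RCLike.norm_ofReal, abs_of_pos (hw0 u)]
  have hue : ∀ (u : U) j, ‖(u : J → 𝕜) j‖ₑ ≤ 1 := fun u j => by
    rw [← ofReal_norm, ← ENNReal.ofReal_one]
    exact ENNReal.ofReal_le_ofReal ((norm_le_pi_norm _ j).trans (hU1 u u.2))
  -- All terms with direction `u` are merged; Hölder on the group gives `‖ζ u‖ₑ ≤ T u * P u`.
  let ζ : U → F := fun u => ∑' k, τ u k • ω u k
  have hζsum : ∀ u, HasSum (fun k => τ u k • ω u k) (ζ u) := fun u =>
    (summable_smul_of_countNorm hp hr hrp (by rw [hτT]; exact hT u)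
      (by rw [hωP]; exact hP u)).hasSum
  have hζ : ∀ u, ‖ζ u‖ₑ ≤ T u * P u := fun u => by
    rw [← hτT, ← hωP]
    exact enorm_tsum_smul_le hp hr hrp _ _
  refine ⟨l, fun j => ?_, fun u => ((w u : ℝ) : 𝕜)⁻¹ • ζ u, ?_, fun j => ?_⟩
  · calc countNorm r (fun u : U => ‖((w u : ℝ) : 𝕜) * (u : J → 𝕜) j‖ₑ)
        ≤ countNorm r (fun u : U => T u * ‖(u : J → 𝕜) j‖ₑ + ENNReal.ofReal η) := by
          refine countNorm_mono fun u => ?_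
          rw [enorm_mul, hwe]
          refine (mul_le_mul_left (hwT u) _).trans ?_
          rw [add_mul]
          gcongr
          exact mul_le_of_le_one_right' (hue u j)
      _ ≤ countNorm r (fun u : U => T u * ‖(u : J → 𝕜) j‖ₑ)
            + countNorm r (fun _ : U => ENNReal.ofReal η) := countNorm_add_le hr
      -- The `2` is the norm of `a j` plus the direction error `δ * c`; the `1` is the rounding.
      _ ≤ 2 + 1 := by
          gcongr
          · have h1 : ∀ u : U, T u * ‖(u : J → 𝕜) j‖ₑ = countNorm r fun k =>
                if b k = u then ‖(b k : J → 𝕜) j‖ₑ * ‖t k‖ₑ else 0 := fun u => by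
              rw [mul_comm, ← countNorm_const_mul hr0]
              congr 1 with k
              split_ifs with h
              · rw [h]
              · simp
            simp only [h1]
            rw [countNorm_fiberwise hr0 (fun k => ‖(b k : J → 𝕜) j‖ₑ * ‖t k‖ₑ) b]
            calc countNorm r (fun k => ‖(b k : J → 𝕜) j‖ₑ * ‖t k‖ₑ)
                ≤ countNorm r (fun k => ‖a j k‖ₑ + ENNReal.ofReal δ * ‖t k‖ₑ) := by
                  refine countNorm_mono fun k => ?_
                  have h2 : ‖(b k : J → 𝕜) j‖ₑ * ‖t k‖ₑ = ‖(‖t k‖ : 𝕜) * (b k : J → 𝕜) j‖ₑ := by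
                    rw [enorm_mul, mul_comm]
                    congr 1
                    rw [← ofReal_norm, ← ofReal_norm, RCLike.norm_ofReal, abs_norm]
                  rw [h2]
                  calc ‖(‖t k‖ : 𝕜) * (b k : J → 𝕜) j‖ₑ
                      = ‖a j k - (a j k - (‖t k‖ : 𝕜) * (b k : J → 𝕜) j)‖ₑ := by
                        rw [_root_.sub_sub_cancel]
                    _ ≤ ‖a j k‖ₑ + ‖a j k - (‖t k‖ : 𝕜) * (b k : J → 𝕜) j‖ₑ := enorm_sub_le
                    _ ≤ _ := by gcongr; exact hbj k j
              _ ≤ countNorm r (fun k => ‖a j k‖ₑ)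
                    + countNorm r (fun k => ENNReal.ofReal δ * ‖t k‖ₑ) := countNorm_add_le hr
              _ ≤ 1 + 1 := by
                  gcongr
                  · exact ha j
                  · rw [countNorm_const_mul hr0]
                    calc _ ≤ ENNReal.ofReal δ * c := by gcongr
                      _ = ENNReal.ofReal (δ * c) := by
                        rw [ENNReal.ofReal_mul hδ0.le, ENNReal.ofReal_natCast]
                      _ ≤ 1 := ENNReal.ofReal_le_one.2 hδ1
              _ = 2 := one_add_one_eq_two
          · refine (countNorm_le_tsum hr _).trans ?_
            rw [tsum_fintype, Finset.sum_const, nsmul_eq_mul, ← ENNReal.ofReal_natCast,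
              ← ENNReal.ofReal_mul (by positivity)]
            refine ENNReal.ofReal_le_one.2 ?_
            rw [hη, mul_one_div, div_le_one (by positivity)]
            simp
      _ = 3 := by norm_num
  · refine (countNorm_mono fun u => ?_).trans hPR
    rw [enorm_smul, enorm_inv (hwk u), hwe, mul_comm, ← div_eq_mul_inv]
    refine ENNReal.div_le_of_le_mul ((hζ u).trans ?_)
    rw [mul_comm]
    gcongr
    exact hTw u
  · have h1 : ∑ u : U, (((η * ((l u : ℕ) + 1) : ℝ) : 𝕜) * (u : J → 𝕜) j) •
        ((w u : ℝ) : 𝕜)⁻¹ • ζ u = ∑ u : U, (u : J → 𝕜) j • ζ u := by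
      refine Finset.sum_congr rfl fun u _ => ?_
      rw [smul_smul, mul_right_comm, mul_inv_cancel₀ (hwk u), one_mul]
    rw [h1]
    have h2 : HasSum (fun k => ((‖t k‖ : 𝕜) * (b k : J → 𝕜) j) • z k)
        (∑ u : U, (u : J → 𝕜) j • ζ u) := by
      have h3 := hasSum_sum (s := Finset.univ)
        fun (u : U) _ => (hζsum u).const_smul ((u : J → 𝕜) j)
      convert h3 using 2 with k
      rw [Finset.sum_eq_single (b k)]
      · simp [τ, ω, smul_smul, mul_comm]
      · intro u _ hu
        simp [τ, hu.symm]
      · simp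
    have h4 := (hx j).sub h2
    simp only [← sub_smul] at h4
    rw [← h4.tsum_eq, ← ENNReal.ofReal_le_ofReal_iff hε.le, ofReal_norm]
    calc _ ≤ countNorm r (fun k => ‖a j k - (‖t k‖ : 𝕜) * (b k : J → 𝕜) j‖ₑ)
          * countNorm p (fun k => ‖z k‖ₑ) := enorm_tsum_smul_le hp hr hrp _ _
      _ ≤ (ENNReal.ofReal δ * c) * R := by
          gcongr
          refine (countNorm_mono fun k => hbj k j).trans ?_
          rw [countNorm_const_mul hr0]
          gcongr
      _ = ENNReal.ofReal (δ * (c * R)) := by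
          rw [ENNReal.ofReal_mul hδ0.le, ENNReal.ofReal_mul (by positivity),
            ENNReal.ofReal_natCast, ENNReal.ofReal_coe_nnreal, mul_assoc]
      _ ≤ ENNReal.ofReal ε := ENNReal.ofReal_le_ofReal hδ2

/-! ### Uniform `(p, r)`-representations of finite families -/

theorem conjExponent_conjExponent {r : ℝ≥0∞} (hr : 1 ≤ r) :
    r.conjExponent.conjExponent = r :=
  (HolderConjugate.conjExponent hr).symm.conjExponent_eq

theorem conjExponent_one : ENNReal.conjExponent 1 = ∞ := by
  simp [ENNReal.conjExponent]

theorem countNorm_apply_le_weakSeqNorm {E : Type*} [NormedAddCommGroup E] [NormedSpace 𝕜 E]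
    (s : ℝ≥0∞) (a : ℕ → StrongDual 𝕜 E) {e : E} (he : ‖e‖ ≤ 1) :
    countNorm s (fun k => ‖a k e‖ₑ) ≤ weakSeqNorm 𝕜 s a := by
  have h := le_iSup₂ (f := fun (f : StrongDual 𝕜 (StrongDual 𝕜 E)) (_ : ‖f‖ ≤ 1) =>
    seqNorm s fun i => f (a i)) (NormedSpace.inclusionInDoubleDual 𝕜 E e)
    ((NormedSpace.double_dual_bound 𝕜 E e).trans he)
  rwa [seqNorm_eq_countNorm] at h

theorem enorm_le_weakSeqNorm_top {F : Type*} [NormedAddCommGroup F] [NormedSpace 𝕜 F]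
    (y : ℕ → F) (k : ℕ) : ‖y k‖ₑ ≤ weakSeqNorm 𝕜 ∞ y := by
  obtain ⟨f, hf, hfy⟩ := exists_dual_vector'' 𝕜 (y k)
  have h := le_iSup₂ (f := fun (f : StrongDual 𝕜 F) (_ : ‖f‖ ≤ 1) =>
    seqNorm ∞ fun i => f (y i)) f hf
  refine le_trans ?_ h
  rw [seqNorm_eq_countNorm]
  refine le_trans ?_ (le_countNorm top_ne_zero _ k)
  rw [hfy, ← ofReal_norm, ← ofReal_norm, RCLike.norm_ofReal, abs_norm]

/-- A `(p, 1, r*)`-nuclear operator maps the unit ball into the `(p, r)`-convex hull of a single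
`p`-summable sequence. -/
theorem exists_hasSum_of_nuclearNorm_lt {p r : ℝ≥0∞} (hp : 1 ≤ p) (hr : 1 ≤ r)
    {E F : Type*} [NormedAddCommGroup E] [NormedSpace 𝕜 E] [NormedAddCommGroup F]
    [NormedSpace 𝕜 F] {S : E →L[𝕜] F} {R : ℝ≥0∞}
    (hS : nuclearNorm p 1 r.conjExponent S < R) :
    ∃ (a : E → ℕ → 𝕜) (z : ℕ → F), countNorm p (fun k => ‖z k‖ₑ) ≤ R ∧
      ∀ e, ‖e‖ ≤ 1 → countNorm r (fun k => ‖a e k‖ₑ) ≤ 1 ∧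
        HasSum (fun k => a e k • z k) (S e) := by
  have hp0 : p ≠ 0 := (one_pos.trans_le hp).ne'
  have hr0 : r ≠ 0 := (one_pos.trans_le hr).ne'
  simp only [nuclearNorm, iInf_lt_iff] at hS
  obtain ⟨σ, a, y, hrep, hlt⟩ := hS
  have hA := hrep.dual_lt_top
  rw [conjExponent_conjExponent hr] at hlt hA
  rw [conjExponent_one] at hlt
  set A := weakSeqNorm 𝕜 r a with hAdef
  set Y := weakSeqNorm 𝕜 ∞ y
  have hc : ‖(A.toReal : 𝕜)‖ₑ = A := by
    rw [← ofReal_norm, RCLike.norm_ofReal, abs_of_nonneg ENNReal.toReal_nonneg,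
      ENNReal.ofReal_toReal hA.ne]
  -- The weak norm `A` is moved from the functionals to the vectors. If `A = 0`, every `a k e`
  -- vanishes and the junk inverse is harmless.
  refine ⟨fun e k => (A.toReal : 𝕜)⁻¹ * a k e, fun k => (A.toReal : 𝕜) • σ k • y k, ?_,
    fun e he => ⟨?_, ?_⟩⟩
  · refine le_trans ?_ hlt.le
    rw [mul_comm, mul_comm (seqNorm p σ), ← mul_assoc, seqNorm_eq_countNorm,
      ← countNorm_const_mul hp0]
    refine countNorm_mono fun k => ?_
    rw [enorm_smul, enorm_smul, hc, mul_comm Y A, mul_assoc, mul_comm Y]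
    gcongr
    exact enorm_le_weakSeqNorm_top y k
  · simp only [enorm_mul]
    rw [countNorm_const_mul hr0]
    refine (mul_le_mul_right (countNorm_apply_le_weakSeqNorm r a he) _).trans ?_
    rw [← hAdef]
    rcases eq_or_ne A 0 with h0 | h0
    · rw [h0, mul_zero]
      exact zero_le
    · rw [enorm_inv, hc, ENNReal.inv_mul_cancel h0 hA.ne]
      simpa [ENNReal.toReal_eq_zero_iff, hA.ne] using h0
  · convert hrep.hasSum e using 2 with k
    rcases eq_or_ne A 0 with h0 | h0
    · have h1 : ‖a k e‖ₑ ≤ 0 := by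
        have h2 := (le_countNorm hr0 _ k).trans (countNorm_apply_le_weakSeqNorm r a he)
        rwa [← hAdef, h0] at h2
      have h3 : a k e = 0 := by simpa using h1
      simp [h3]
    · have hne : (A.toReal : 𝕜) ≠ 0 := by
        simpa [ENNReal.toReal_eq_zero_iff, hA.ne] using h0
      rw [smul_smul, smul_smul]
      congr 1
      field_simp

/-- Simultaneous approximation by one of finitely many systems of linear combinations is detected
by the finite-dimensional quotients. -/
theorem exists_approx_of_quotients {p : ℝ≥0∞} (hp : 1 ≤ p) {ι Λ J : Type} [Fintype ι] [Fintype Λ]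
    [Fintype J] (G : Set Λ) (α : Λ → ι → J → 𝕜) (R : NNReal) {ε : ℝ} (hε : 0 < ε)
    {X : Type u} [NormedAddCommGroup X] [NormedSpace 𝕜 X] (x : J → X)
    (h : ∀ (M : Submodule 𝕜 X) [IsClosed (M : Set X)] [FiniteDimensional 𝕜 (X ⧸ M)],
      ∃ l ∈ G, ∃ z : ι → X ⧸ M, countNorm p (fun i => ‖z i‖ₑ) ≤ R ∧
        ∀ j, ‖M.mkQ (x j) - ∑ i, α l i j • z i‖ ≤ ε) :
    ∃ l ∈ G, ∃ z : ι → X, countNorm p (fun i => ‖z i‖ₑ) ≤ 2 * R ∧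
      ∀ j, ‖x j - ∑ i, α l i j • z i‖ < 2 * ε := by
  classical
  have hp0 : p ≠ 0 := (one_pos.trans_le hp).ne'
  let : NormedSpace ℝ X := NormedSpace.restrictScalars ℝ 𝕜 X
  have : IsScalarTower ℝ 𝕜 X := IsScalarTower.of_algebraMap_smul fun _ _ => rfl
  have : SMulCommClass ℝ 𝕜 X := ⟨fun s c v => by
    rw [← algebraMap_smul 𝕜 s (c • v), ← algebraMap_smul 𝕜 s v, smul_comm]⟩
  -- Families approximable in `X` with system `l`. The factors `2` leave room for lifting from
  -- quotients, and the strict inequality makes the set open.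
  let W : Λ → Set (J → X) := fun l => {v | ∃ z : ι → X, countNorm p (fun i => ‖z i‖ₑ) ≤ 2 * R ∧
    ∀ j, ‖v j - ∑ i, α l i j • z i‖ < 2 * ε}
  suffices hW : ∃ l ∈ G, x ∈ W l from hW
  by_contra! hcon
  have hconv : ∀ l, Convex ℝ (W l) := by
    rintro l v ⟨z, hz, hv⟩ v' ⟨z', hz', hv'⟩ s t hs ht hst
    refine ⟨fun i => s • z i + t • z' i, ?_, fun j => ?_⟩
    · calc countNorm p (fun i => ‖s • z i + t • z' i‖ₑ)
          ≤ countNorm p (fun i => ENNReal.ofReal s * ‖z i‖ₑ + ENNReal.ofReal t * ‖z' i‖ₑ) := by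
            refine countNorm_mono fun i => (enorm_add_le _ _).trans_eq ?_
            rw [enorm_smul, enorm_smul, Real.enorm_of_nonneg hs, Real.enorm_of_nonneg ht]
        _ ≤ ENNReal.ofReal s * (2 * R) + ENNReal.ofReal t * (2 * R) := by
            refine (countNorm_add_le hp).trans ?_
            rw [countNorm_const_mul hp0, countNorm_const_mul hp0]
            gcongr
        _ = 2 * R := by
            rw [← add_mul, ← ENNReal.ofReal_add hs ht, hst, ENNReal.ofReal_one, one_mul]
    · have h1 : (s • v + t • v') j - ∑ i, α l i j • (s • z i + t • z' i)
          = s • (v j - ∑ i, α l i j • z i) + t • (v' j - ∑ i, α l i j • z' i) := by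
        simp only [smul_add, Finset.sum_add_distrib, smul_sub, Finset.smul_sum, Pi.add_apply,
          Pi.smul_apply, smul_comm (α l _ j)]
        abel
      have h2 := (convex_ball (0 : X) (2 * ε)) (mem_ball_zero_iff.2 (hv j))
        (mem_ball_zero_iff.2 (hv' j)) hs ht hst
      rw [h1]
      exact mem_ball_zero_iff.1 h2
  have hopen : ∀ l, IsOpen (W l) := by
    intro l
    have : W l = ⋃ z ∈ {z : ι → X | countNorm p (fun i => ‖z i‖ₑ) ≤ 2 * R},
        ⋂ j, {v : J → X | ‖v j - ∑ i, α l i j • z i‖ < 2 * ε} := by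
      ext v
      simp [W]
    rw [this]
    refine isOpen_biUnion fun z _ => isOpen_iInter_of_finite fun j => ?_
    exact isOpen_lt (by fun_prop) continuous_const
  have hsep : ∀ l, ∃ φ : StrongDual 𝕜 (J → X), l ∈ G → ∀ v ∈ W l,
      RCLike.re (φ v) < RCLike.re (φ x) := fun l => by
    by_cases hl : l ∈ G
    · obtain ⟨φ, hφ⟩ := RCLike.geometric_hahn_banach_open_point (𝕜 := 𝕜) (hconv l) (hopen l)
        (hcon l hl)
      exact ⟨φ, fun _ => hφ⟩
    · exact ⟨0, fun hl' => absurd hl' hl⟩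
  choose φ hφ using hsep
  -- The components of all separating functionals; their common kernel has finite codimension
  -- because `Λ × J` is finite.
  let Φ : X →L[𝕜] (Λ × J → 𝕜) := ContinuousLinearMap.pi fun q =>
    (φ q.1).comp (ContinuousLinearMap.single 𝕜 (fun _ : J => X) q.2)
  let M : Submodule 𝕜 X := LinearMap.ker (Φ : X →ₗ[𝕜] (Λ × J → 𝕜))
  have : IsClosed (M : Set X) := Φ.isClosed_ker
  have : FiniteDimensional 𝕜 (X ⧸ M) :=
    (LinearMap.quotKerEquivRange (Φ : X →ₗ[𝕜] (Λ × J → 𝕜))).symm.finiteDimensional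
  obtain ⟨l, hl, z, hz, hxz⟩ := h M
  have hlift : ∀ i, ∃ m : X, M.mkQ m = z i ∧ ‖m‖ ≤ 2 * ‖z i‖ := fun i => by
    rcases eq_or_ne (z i) 0 with h0 | h0
    · exact ⟨0, by simp [h0]⟩
    · obtain ⟨m, hm, hlt⟩ := Submodule.Quotient.norm_mk_lt (z i) (norm_pos_iff.2 h0)
      exact ⟨m, hm, by linarith⟩
  choose z' hz' hzn using hlift
  have herr : ∀ j, ∃ m : X, M.mkQ m = M.mkQ (x j) - ∑ i, α l i j • z i ∧ ‖m‖ < 2 * ε := fun j => by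
    obtain ⟨m, hm, hlt⟩ := Submodule.Quotient.norm_mk_lt (M.mkQ (x j) - ∑ i, α l i j • z i) hε
    exact ⟨m, hm, by linarith [hxz j]⟩
  choose m hm hmn using herr
  -- The solution in the quotient, lifted: it lies in `W l` but differs from `x` only by elements of
  -- `M`, so `φ l` cannot separate them.
  let v : J → X := fun j => m j + ∑ i, α l i j • z' i
  have hv : v ∈ W l := by
    refine ⟨z', ?_, fun j => by simpa [v] using hmn j⟩
    calc countNorm p (fun i => ‖z' i‖ₑ) ≤ countNorm p (fun i => 2 * ‖z i‖ₑ) := by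
          refine countNorm_mono fun i => ?_
          rw [← ofReal_norm, ← ofReal_norm]
          refine (ENNReal.ofReal_le_ofReal (hzn i)).trans_eq ?_
          rw [ENNReal.ofReal_mul zero_le_two]
          norm_num
      _ ≤ 2 * R := by
          rw [countNorm_const_mul hp0]
          gcongr
  have hker : ∀ j, v j - x j ∈ M := fun j => by
    rw [← Submodule.ker_mkQ M, LinearMap.mem_ker]
    simp only [v, map_sub, map_add, hm, map_sum, map_smul, hz']
    abel
  have hzero : φ l (v - x) = 0 := by
    have h1 : v - x = ∑ j, Pi.single j ((v - x) j) := (Finset.univ_sum_single (v - x)).symm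
    rw [h1, map_sum]
    refine Finset.sum_eq_zero fun j _ => ?_
    exact congrFun (LinearMap.mem_ker.1 (hker j)) (l, j)
  have := hφ l hl v hv
  rw [map_sub, sub_eq_zero] at hzero
  rw [hzero] at this
  exact lt_irrefl _ this

/-- An integral operator maps finite subsets of the unit ball into `(p, r)`-convex hulls of finite
families, uniformly. -/
theorem exists_finite_rep_of_integral {p r : ℝ≥0∞} (hp : 1 ≤ p) (hr : 1 ≤ r)
    (hrp : r ≤ p.conjExponent) {Z X : Type u} [NormedAddCommGroup Z] [NormedSpace 𝕜 Z]
    [CompleteSpace Z] [NormedAddCommGroup X] [NormedSpace 𝕜 X] [CompleteSpace X] {S : Z →L[𝕜] X}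
    (hS : S ∈ integralOperators.{u} 𝕜 p 1 r.conjExponent Z X) :
    ∃ C : NNReal, ∀ (J : Type) [Fintype J] (w : J → Z), (∀ j, ‖w j‖ ≤ 1) →
      ∃ (ι : Type) (_ : Fintype ι) (a : J → ι → 𝕜) (z : ι → X),
        countNorm p (fun i => ‖z i‖ₑ) ≤ C ∧
        ∀ j, countNorm r (fun i => ‖a j i‖ₑ) ≤ 4 ∧ S (w j) = ∑ i, a j i • z i := by
  classical
  obtain ⟨ρ, hρ, hS⟩ := hS
  lift ρ to NNReal using hρ.ne
  -- `ρ + 1` lies strictly above the infimum, the factor `2` is the lifting loss, and the last `1`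
  -- pays for the correction vectors.
  refine ⟨2 * (ρ + 1) + 1, fun J _ w hw => ?_⟩
  set ε : ℝ := 1 / (2 * (Fintype.card J + 1)) with hε
  have hε0 : 0 < ε := by positivity
  obtain ⟨ι, Λ, _, _, α, hα⟩ := exists_finite_discretization.{u} (𝕜 := 𝕜) hp hr hrp J (ρ + 1) hε0
  let E : Submodule 𝕜 Z := Submodule.span 𝕜 (Set.range w)
  have : FiniteDimensional 𝕜 E := FiniteDimensional.span_of_finite 𝕜 (Set.finite_range w)
  obtain ⟨l, hl, z, hz, hxz⟩ := exists_approx_of_quotients hp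
    {l : Λ | ∀ j, countNorm r (fun i => ‖α l i j‖ₑ) ≤ 3} α (ρ + 1) hε0 (fun j => S (w j)) <| by
      intro M _ _
      have hmk : ‖M.mkQL‖ ≤ 1 := ContinuousLinearMap.opNorm_le_bound _ zero_le_one fun v => by
        rw [one_mul]
        exact Submodule.Quotient.norm_mk_le (S := M) v
      have hlt := (hS E (X ⧸ M) E.subtypeL M.mkQL (Submodule.norm_subtypeL_le E) hmk).trans_lt
        (b := (ρ : ℝ≥0∞)) (c := (ρ + 1 : NNReal)) (by exact_mod_cast lt_add_one ρ)
      obtain ⟨a, y, hy, hrep⟩ := exists_hasSum_of_nuclearNorm_lt hp hr hlt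
      have : CompleteSpace (X ⧸ M) := FiniteDimensional.complete 𝕜 _
      let e : J → E := fun j => ⟨w j, Submodule.subset_span (Set.mem_range_self j)⟩
      exact hα (X ⧸ M) (fun j => a (e j)) y (fun j => M.mkQ (S (w j)))
        (fun j => (hrep (e j) (hw j)).1) hy (fun j => (hrep (e j) (hw j)).2)
  -- The approximation becomes exact by adjoining each error as a vector with coefficient `1`; this
  -- raises the coefficient bound from `3` to `4`.
  refine ⟨ι ⊕ J, inferInstance,
    fun j => Sum.elim (fun i => α l i j) (fun k => if k = j then 1 else 0),
    Sum.elim z fun j => S (w j) - ∑ i, α l i j • z i, ?_, fun j => ⟨?_, ?_⟩⟩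
  · have h1 : (fun i => ‖Sum.elim z (fun j => S (w j) - ∑ i, α l i j • z i) i‖ₑ) =
        Sum.elim (fun i => ‖z i‖ₑ) (fun j => ‖S (w j) - ∑ i, α l i j • z i‖ₑ) := by
      ext (i | i) <;> rfl
    rw [h1]
    refine (countNorm_sum_elim_le hp _ _).trans ?_
    rw [ENNReal.coe_add, ENNReal.coe_mul]
    refine add_le_add hz ((countNorm_le_tsum hp _).trans ?_)
    rw [tsum_fintype]
    calc ∑ j, ‖S (w j) - ∑ i, α l i j • z i‖ₑ ≤ ∑ _j : J, ENNReal.ofReal (2 * ε) :=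
          Finset.sum_le_sum fun j _ => by
            rw [← ofReal_norm]
            exact ENNReal.ofReal_le_ofReal (hxz j).le
      _ = ENNReal.ofReal (Fintype.card J * (2 * ε)) := by
          rw [Finset.sum_const, nsmul_eq_mul, ← ENNReal.ofReal_natCast,
            ← ENNReal.ofReal_mul (by positivity), Finset.card_univ]
      _ ≤ 1 := by
          refine ENNReal.ofReal_le_one.2 ?_
          rw [hε, ← mul_assoc, mul_one_div, div_le_one (by positivity)]
          linarith
  · have h1 : (fun i => ‖Sum.elim (fun i => α l i j) (fun k => if k = j then (1 : 𝕜) else 0) i‖ₑ) =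
        Sum.elim (fun i => ‖α l i j‖ₑ) (fun k => if k = j then 1 else 0) := by
      ext (i | i)
      · rfl
      · simp only [Sum.elim_inr]
        split_ifs <;> simp
    rw [h1]
    refine (countNorm_sum_elim_le hr _ _).trans ?_
    calc _ ≤ (3 : ℝ≥0∞) + 1 := by
          gcongr
          · exact hl j
          · refine (countNorm_le_tsum hr _).trans ?_
            rw [tsum_ite_eq]
      _ = 4 := by norm_num
  · simp [Fintype.sum_sum_type]

/-! ### Null sequences and integral operators -/

theorem exists_block {φ : ℕ → ℕ} (hφ : StrictMono φ) {n : ℕ} (h0 : φ 0 ≤ n) :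
    ∃ m, φ m ≤ n ∧ n < φ (m + 1) := by
  have hex : ∃ k, n < φ k := ⟨n + 1, (Nat.lt_succ_self n).trans_le (hφ.id_le (n + 1))⟩
  obtain ⟨m, hm⟩ : ∃ m, Nat.find hex = m + 1 := Nat.exists_eq_succ_of_ne_zero fun h => by
    have := Nat.find_spec hex
    rw [h] at this
    exact this.not_ge h0
  refine ⟨m, not_lt.1 (Nat.find_min hex (by lia)), ?_⟩
  rw [← hm]
  exact Nat.find_spec hex

theorem enorm_extend {ι κ E : Type*} [NormedAddCommGroup E] {e : ι → κ} (he : e.Injective)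
    (f : ι → E) (k : κ) :
    ‖Function.extend e f 0 k‖ₑ = Function.extend e (fun i => ‖f i‖ₑ) 0 k := by
  by_cases h : ∃ i, e i = k
  · obtain ⟨i, rfl⟩ := h
    rw [he.extend_apply, he.extend_apply]
  · rw [Function.extend_apply' _ _ _ h, Function.extend_apply' _ _ _ h]
    simp

theorem countNorm_enorm_extend {ι κ E : Type*} [NormedAddCommGroup E] {s : ℝ≥0∞} (h0 : s ≠ 0)
    {e : ι → κ} (he : e.Injective) (f : ι → E) :
    countNorm s (fun k => ‖Function.extend e f 0 k‖ₑ) = countNorm s fun i => ‖f i‖ₑ := by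
  simp only [enorm_extend he]
  exact countNorm_extend h0 he _

theorem hasSum_extend_smul_iff {ι κ E : Type*} [NormedAddCommGroup E] [NormedSpace 𝕜 E]
    {e : ι → κ} (he : e.Injective) (a : ι → 𝕜) (z : κ → E) {s : E} :
    HasSum (fun k => Function.extend e a 0 k • z k) s ↔ HasSum (fun i => a i • z (e i)) s := by
  rw [← hasSum_extend_zero he]
  refine iff_of_eq (congrArg (HasSum · s) (funext fun k => ?_))
  by_cases h : ∃ i, e i = k
  · obtain ⟨i, rfl⟩ := h
    rw [he.extend_apply, he.extend_apply]
  · rw [Function.extend_apply' _ _ _ h, Function.extend_apply' _ _ _ h]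
    simp

theorem tendsto_extend_zero {ι E : Type*} [Finite ι] [NormedAddCommGroup E] (e : ι → ℕ)
    (f : ι → E) : Tendsto (Function.extend e f 0) atTop (𝓝 0) := by
  refine tendsto_const_nhds.congr' ?_
  rw [← Nat.cofinite_eq_atTop]
  filter_upwards [(Set.finite_range e).eventually_cofinite_notMem] with k hk
  rw [Function.extend_apply' _ _ _ hk]
  rfl

theorem enorm_rclike_ofReal {t : ℝ} (ht : 0 ≤ t) : ‖(t : 𝕜)‖ₑ = ENNReal.ofReal t := by
  rw [← ofReal_norm, RCLike.norm_ofReal, abs_of_nonneg ht]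

/-- Integral operators map null sequences to `(p, r)`-null sequences. -/
theorem isPRNull_of_integral {p r : ℝ≥0∞} (hp : 1 ≤ p) (hr : 1 ≤ r)
    (hrp : r ≤ p.conjExponent) {Z X : Type u} [NormedAddCommGroup Z] [NormedSpace 𝕜 Z]
    [CompleteSpace Z] [NormedAddCommGroup X] [NormedSpace 𝕜 X] [CompleteSpace X] {S : Z →L[𝕜] X}
    (hS : S ∈ integralOperators.{u} 𝕜 p 1 r.conjExponent Z X) {w : ℕ → Z}
    (hw : Tendsto w atTop (𝓝 0)) : IsPRNull 𝕜 p r fun n => S (w n) := by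
  have hp0 : p ≠ 0 := (one_pos.trans_le hp).ne'
  have hr0 : r ≠ 0 := (one_pos.trans_le hr).ne'
  obtain ⟨C, hC⟩ := exists_finite_rep_of_integral hp hr hrp hS
  intro ε hε
  -- Chosen so that `4 * δ m * C ≤ ε / 2 * (1 / 2) ^ m`, which sums to `ε`.
  let δ : ℕ → ℝ := fun m => ε / (8 * (C + 1)) * (1 / 2) ^ m
  have hδ : ∀ m, 0 < δ m := fun m => by positivity
  obtain ⟨φ, hφ, hwφ⟩ := extraction_forall_of_eventually
    (P := fun m k => ∀ n ≥ k, ‖w n‖ ≤ δ m) fun m => by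
      have h1 : ∀ᶠ n in atTop, ‖w n‖ ≤ δ m := by
        have h2 := hw.norm
        rw [norm_zero] at h2
        exact h2.eventually_le_const (hδ m)
      obtain ⟨k, hk⟩ := eventually_atTop.1 h1
      filter_upwards [eventually_ge_atTop k] with k' hk' n hn
      exact hk n (hk'.trans hn)
  have hblock : ∀ m, ∃ (ι : Type) (_ : Fintype ι) (a : Finset.Ico (φ m) (φ (m + 1)) → ι → 𝕜)
      (z : ι → X), countNorm p (fun i => ‖z i‖ₑ) ≤ C ∧
        ∀ j, countNorm r (fun i => ‖a j i‖ₑ) ≤ 4 ∧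
          S ((δ m : 𝕜)⁻¹ • w j) = ∑ i, a j i • z i := fun m => by
    refine hC (Finset.Ico (φ m) (φ (m + 1))) (fun j => (δ m : 𝕜)⁻¹ • w j) fun j => ?_
    rw [norm_smul, norm_inv, RCLike.norm_ofReal, abs_of_pos (hδ m), inv_mul_le_one₀ (hδ m)]
    exact hwφ m j (Finset.mem_Ico.1 j.2).1
  choose ι _ a z hz haz using hblock
  obtain ⟨e, he⟩ := exists_injective_nat (Σ m, ι m)
  let y : (Σ m, ι m) → X := fun q => ((4 * δ q.1 : ℝ) : 𝕜) • z q.1 q.2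
  refine ⟨Function.extend e y 0, ?_, φ 0, fun n hn => ?_⟩
  · rw [seqNorm_eq_countNorm, countNorm_enorm_extend hp0 he, countNorm_sigma hp0]
    refine (countNorm_le_tsum hp _).trans ?_
    have h1 : ∀ m, countNorm p (fun i => ‖y ⟨m, i⟩‖ₑ) ≤ ENNReal.ofReal (ε / 2 * (1 / 2) ^ m) := by
      intro m
      simp only [y, enorm_smul, enorm_rclike_ofReal (mul_pos four_pos (hδ m)).le]
      rw [countNorm_const_mul hp0]
      calc _ ≤ ENNReal.ofReal (4 * δ m) * C := by gcongr; exact hz m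
        _ = ENNReal.ofReal (4 * δ m * C) := by
          rw [ENNReal.ofReal_mul (p := 4 * δ m) (mul_pos four_pos (hδ m)).le,
            ENNReal.ofReal_coe_nnreal]
        _ ≤ _ := by
          refine ENNReal.ofReal_le_ofReal ?_
          have hC1 : (C : ℝ) / (C + 1) ≤ 1 := (div_le_one (by positivity)).2 (by linarith)
          calc 4 * δ m * C = ε / 2 * (1 / 2) ^ m * (C / (C + 1)) := by
                simp only [δ]
                field_simp
                ring
            _ ≤ ε / 2 * (1 / 2) ^ m * 1 := by gcongr
            _ = _ := mul_one _
    refine (ENNReal.tsum_le_tsum h1).trans_eq ?_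
    rw [← ENNReal.ofReal_tsum_of_nonneg (fun m => by positivity)
      (summable_geometric_two.mul_left _), tsum_mul_left, tsum_geometric_two,
      div_mul_cancel₀ _ two_ne_zero]
  · obtain ⟨m, hm, hm'⟩ := exists_block hφ hn
    let j : Finset.Ico (φ m) (φ (m + 1)) := ⟨n, Finset.mem_Ico.2 ⟨hm, hm'⟩⟩
    have he' : Function.Injective fun i => e ⟨m, i⟩ := he.comp sigma_mk_injective
    refine ⟨Function.extend (fun i => e ⟨m, i⟩) (fun i => (4 : 𝕜)⁻¹ * a m j i) 0, ?_,
      fun _ => tendsto_extend_zero _ _, ?_⟩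
    · rw [seqNorm_eq_countNorm, countNorm_enorm_extend hr0 he']
      simp only [enorm_mul]
      have h4' : (4 : 𝕜) ≠ 0 := by
        rw [← norm_ne_zero_iff, RCLike.norm_ofNat]
        norm_num
      have h4 : ‖(4 : 𝕜)‖ₑ = 4 := by
        rw [← ofReal_norm, RCLike.norm_ofNat]
        norm_num
      rw [countNorm_const_mul hr0, enorm_inv h4', h4]
      calc _ ≤ (4 : ℝ≥0∞)⁻¹ * 4 := by gcongr; exact (haz m j).1
        _ = 1 := ENNReal.inv_mul_cancel (by norm_num) (by norm_num)
    · rw [hasSum_extend_smul_iff (𝕜 := 𝕜) he']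
      convert hasSum_fintype _ using 1
      have h1 := congrArg (fun v => (δ m : 𝕜) • v) (haz m j).2
      have hδ' : (δ m : 𝕜) ≠ 0 := RCLike.ofReal_ne_zero.2 (hδ m).ne'
      simp only [map_smul, smul_inv_smul₀ hδ'] at h1
      change S (w j) = _
      rw [h1, Finset.smul_sum]
      refine Finset.sum_congr rfl fun i _ => ?_
      rw [he.extend_apply, smul_smul, smul_smul]
      congr 1
      push_cast
      field_simp

/-! ### Integral operators defined by `p`-summable sequences -/

theorem countNorm_equiv {ι κ : Type*} {s : ℝ≥0∞} (h0 : s ≠ 0) (e : ι ≃ κ) (f : κ → ℝ≥0∞) :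
    countNorm s (fun i => f (e i)) = countNorm s f := by
  rcases eq_or_ne s ∞ with rfl | ht
  · rw [countNorm_top, countNorm_top, e.iSup_comp (g := f)]
  · rw [countNorm_eq_tsum h0 ht, countNorm_eq_tsum h0 ht, e.tsum_eq fun i => f i ^ s.toReal]

theorem lp_enorm_eq_countNorm {ι : Type*} {s : ℝ≥0∞} [Fact (1 ≤ s)]
    (v : lp (fun _ : ι => 𝕜) s) : ‖v‖ₑ = countNorm s fun i => ‖v i‖ₑ := by
  have h0 : s ≠ 0 := (one_pos.trans_le (Fact.out : 1 ≤ s)).ne'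
  rcases eq_or_ne s ∞ with rfl | ht
  · rw [countNorm_top]
    refine le_antisymm ?_ (iSup_le fun i => ?_)
    · by_cases h : ⨆ i, ‖v i‖ₑ = ∞
      · rw [h]
        exact le_top
      rw [← ENNReal.ofReal_toReal h, ← ofReal_norm]
      refine ENNReal.ofReal_le_ofReal
        (lp.norm_le_of_forall_le ENNReal.toReal_nonneg fun i => ?_)
      rw [← toReal_enorm]
      exact ENNReal.toReal_mono h (le_iSup (fun i => ‖v i‖ₑ) i)
    · rw [← ofReal_norm, ← ofReal_norm]
      exact ENNReal.ofReal_le_ofReal (lp.norm_apply_le_norm h0 v i)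
  · have hs := ENNReal.toReal_pos h0 ht
    refine ENNReal.rpow_left_injective hs.ne' ?_
    simp only [countNorm_rpow h0 ht, ← ofReal_norm, ENNReal.ofReal_rpow_of_nonneg (norm_nonneg _)
      hs.le]
    rw [lp.norm_rpow_eq_tsum hs, ENNReal.ofReal_tsum_of_nonneg (fun i => by positivity)
      ((lp.memℓp v).summable hs)]

theorem memℓp_of_countNorm {ι : Type*} {s : ℝ≥0∞} (h0 : s ≠ 0) {a : ι → 𝕜}
    (ha : countNorm s (fun i => ‖a i‖ₑ) ≠ ∞) : Memℓp a s := by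
  rcases eq_or_ne s ∞ with rfl | ht
  · refine memℓp_infty ⟨(countNorm ∞ fun i => ‖a i‖ₑ).toReal, ?_⟩
    rintro _ ⟨i, rfl⟩
    change ‖a i‖ ≤ _
    rw [← toReal_enorm]
    exact ENNReal.toReal_mono ha (le_countNorm top_ne_zero (fun i => ‖a i‖ₑ) i)
  · have hs := ENNReal.toReal_pos h0 ht
    refine memℓp_gen ?_
    have h1 : ∑' i, ‖a i‖ₑ ^ s.toReal ≠ ∞ := by
      rw [← countNorm_rpow h0 ht]
      exact ENNReal.rpow_ne_top_of_nonneg hs.le ha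
    convert ENNReal.summable_toReal h1 using 2 with i
    rw [← ENNReal.toReal_rpow, toReal_enorm]

/-- Finite-dimensional spaces are reflexive, so weak norms of functionals can be tested on vectors.
-/
theorem exists_eq_apply_of_finiteDimensional {E : Type*} [NormedAddCommGroup E] [NormedSpace 𝕜 E]
    [FiniteDimensional 𝕜 E] (f : StrongDual 𝕜 (StrongDual 𝕜 E)) :
    ∃ e : E, ‖e‖ = ‖f‖ ∧ ∀ g : StrongDual 𝕜 E, f g = g e := by
  have hfin : ∀ (V : Type _) [NormedAddCommGroup V] [NormedSpace 𝕜 V] [FiniteDimensional 𝕜 V],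
      Module.finrank 𝕜 (StrongDual 𝕜 V) = Module.finrank 𝕜 V := fun V _ _ _ =>
    (LinearMap.toContinuousLinearMap (𝕜 := 𝕜) (E := V) (F' := 𝕜)).symm.finrank_eq.trans
      Subspace.dual_finrank_eq
  have hsurj : Function.Surjective (NormedSpace.inclusionInDoubleDualLi 𝕜 (E := E)).toLinearMap :=
    (LinearMap.injective_iff_surjective_of_finrank_eq_finrank
      ((hfin _).trans (hfin E)).symm).1 (NormedSpace.inclusionInDoubleDualLi 𝕜).injective
  obtain ⟨e, rfl⟩ := hsurj f
  exact ⟨e, ((NormedSpace.inclusionInDoubleDualLi 𝕜).norm_map e).symm, fun g => rfl⟩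

/-- The `(p, r)`-convex hull of a `p`-summable sequence lies in the image of the unit ball under an
integral operator. -/
theorem exists_integral_of_countNorm {p r : ℝ≥0∞} (hp : 1 ≤ p) (hp_top : p < ∞) (hr : 1 ≤ r)
    (hrp : r ≤ p.conjExponent) {X : Type u} [NormedAddCommGroup X] [NormedSpace 𝕜 X]
    [CompleteSpace X] {z : ℕ → X} (hz : countNorm p (fun k => ‖z k‖ₑ) ≠ ∞) :
    ∃ (Z : Type u) (_ : NormedAddCommGroup Z) (_ : NormedSpace 𝕜 Z) (_ : CompleteSpace Z)
      (S : Z →L[𝕜] X), S ∈ integralOperators.{u} 𝕜 p 1 r.conjExponent Z X ∧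
        ∀ (a : ℕ → 𝕜) (x : X), countNorm r (fun k => ‖a k‖ₑ) ≤ 1 →
          HasSum (fun k => a k • z k) x → ∃ v, ‖v‖ ≤ 1 ∧ S v = x := by
  have hp0 : p ≠ 0 := (one_pos.trans_le hp).ne'
  have hr0 : r ≠ 0 := (one_pos.trans_le hr).ne'
  have : Fact (1 ≤ r) := ⟨hr⟩
  -- For `r = ∞` this is all of `ℓ_∞` rather than `c₀`; the series still converge, as then `p = 1`.
  let Z : Type u := lp (fun _ : ULift.{u} ℕ => 𝕜) r
  have hnorm : ∀ v : Z, countNorm r (fun k : ℕ => ‖v ⟨k⟩‖ₑ) = ‖v‖ₑ := fun v => by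
    rw [lp_enorm_eq_countNorm v]
    exact countNorm_equiv hr0 Equiv.ulift.symm fun i => ‖v i‖ₑ
  have hsum : ∀ v : Z, Summable fun k : ℕ => v ⟨k⟩ • z k := fun v =>
    summable_smul_of_countNorm hp hr hrp (by rw [hnorm]; exact enorm_ne_top) hz
  let S₀ : Z →ₗ[𝕜] X :=
    { toFun := fun v => ∑' k : ℕ, v ⟨k⟩ • z k
      map_add' := fun v w => by
        rw [← (hsum v).tsum_add (hsum w)]
        simp only [← add_smul]
        rfl
      map_smul' := fun c v => by
        rw [RingHom.id_apply, ← (hsum v).tsum_const_smul]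
        simp only [smul_smul]
        rfl }
  let S : Z →L[𝕜] X := S₀.mkContinuous (countNorm p fun k => ‖z k‖ₑ).toReal fun v => by
    have h1 := enorm_tsum_smul_le hp hr hrp (fun k : ℕ => v ⟨k⟩) z
    rw [hnorm, mul_comm] at h1
    have h2 := ENNReal.toReal_mono (ENNReal.mul_ne_top hz enorm_ne_top) h1
    rwa [ENNReal.toReal_mul, toReal_enorm, toReal_enorm] at h2
  have hS : ∀ v : Z, HasSum (fun k : ℕ => v ⟨k⟩ • z k) (S v) := fun v => (hsum v).hasSum
  refine ⟨Z, inferInstance, inferInstance, inferInstance, S, ?_, fun a x ha hx => ?_⟩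
  · refine ⟨countNorm p fun k => ‖z k‖ₑ, hz.lt_top, ?_⟩
    intro E₀ F₀ _ _ _ _ _ _ A B hA hB
    let σ : ℕ → 𝕜 := fun k => (‖z k‖ : 𝕜)
    let a : ℕ → StrongDual 𝕜 E₀ := fun k =>
      (lp.evalCLM 𝕜 (fun _ : ULift.{u} ℕ => 𝕜) r ⟨k⟩).comp A
    let y : ℕ → F₀ := fun k => (σ k)⁻¹ • B (z k)
    have hσ : seqNorm p σ = countNorm p fun k => ‖z k‖ₑ := by
      rw [seqNorm_eq_countNorm]
      simp only [σ, enorm_rclike_ofReal (norm_nonneg _), ofReal_norm]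
    have ha : weakSeqNorm 𝕜 r a ≤ 1 := by
      refine iSup₂_le fun f hf => ?_
      obtain ⟨e, he, hfe⟩ := exists_eq_apply_of_finiteDimensional f
      rw [seqNorm_eq_countNorm]
      simp only [hfe]
      refine (hnorm (A e)).trans_le ?_
      rw [← ofReal_norm]
      refine ENNReal.ofReal_le_one.2 ((A.le_opNorm e).trans ?_)
      exact mul_le_one₀ hA (norm_nonneg _) (he.trans_le hf)
    have hy : weakSeqNorm 𝕜 ∞ y ≤ 1 := by
      refine iSup₂_le fun f hf => ?_
      rw [seqNorm_eq_countNorm, countNorm_top]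
      refine iSup_le fun k => ?_
      rw [← ofReal_norm]
      refine ENNReal.ofReal_le_one.2 ((f.le_opNorm _).trans (mul_le_one₀ hf (norm_nonneg _) ?_))
      rw [norm_smul, norm_inv, RCLike.norm_ofReal, abs_norm]
      refine (mul_le_mul_of_nonneg_left ((B.le_opNorm _).trans
        (mul_le_of_le_one_left (norm_nonneg _) hB)) (by positivity)).trans ?_
      exact inv_mul_le_one
    have hrep : IsNuclearRep p 1 r.conjExponent (B.comp (S.comp A)) σ a y :=
      { scalar_lt_top := hσ ▸ hz.lt_top
        scalar_null := fun h => absurd h hp_top.ne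
        dual_lt_top := by
          rw [conjExponent_conjExponent hr]
          exact ha.trans_lt one_lt_top
        vector_lt_top := by
          rw [conjExponent_one]
          exact hy.trans_lt one_lt_top
        hasSum := fun e => by
          refine (B.hasSum (hS (A e))).congr_fun fun k => ?_
          rw [map_smul]
          by_cases h0 : z k = 0
          · simp [y, h0]
          · have h1 : σ k ≠ 0 := RCLike.ofReal_ne_zero.2 (norm_ne_zero_iff.2 h0)
            rw [smul_smul, mul_right_comm, mul_inv_cancel₀ h1, one_mul]
            rfl }
    refine (iInf₂_le_of_le σ a (iInf₂_le_of_le y hrep le_rfl)).trans ?_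
    rw [conjExponent_conjExponent hr, conjExponent_one, hσ]
    calc _ ≤ (countNorm p fun k => ‖z k‖ₑ) * 1 * 1 := by gcongr
      _ = _ := by rw [mul_one, mul_one]
  · have ha' : countNorm r (fun i : ULift.{u} ℕ => ‖a i.down‖ₑ) ≤ 1 :=
      (countNorm_equiv hr0 Equiv.ulift fun k => ‖a k‖ₑ).trans_le ha
    let v : Z := ⟨fun i => a i.down, memℓp_of_countNorm hr0 (ne_top_of_le_ne_top one_ne_top ha')⟩
    refine ⟨v, ?_, (hS v).unique hx⟩
    rw [← ENNReal.ofReal_le_one, ofReal_norm, lp_enorm_eq_countNorm v]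
    exact ha'

/-- The factor `4⁻ᵐ` is shared: one `2⁻ᵐ` keeps the glued sequence `p`-summable, the other makes the
preimages null. -/
theorem isOpNull_of_isPRNull {p r : ℝ≥0∞} (hp : 1 ≤ p) (hp_top : p < ∞) (hr : 1 ≤ r)
    (hrp : r ≤ p.conjExponent) {X : Type u} [NormedAddCommGroup X] [NormedSpace 𝕜 X]
    [CompleteSpace X] {x : ℕ → X} (hx : IsPRNull 𝕜 p r x) :
    IsOpNull (integralOperators.{u} 𝕜 p 1 r.conjExponent) x := by
  have hp0 : p ≠ 0 := (one_pos.trans_le hp).ne'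
  have hr0 : r ≠ 0 := (one_pos.trans_le hr).ne'
  choose z hz N hN using fun m : ℕ => hx ((1 / 4) ^ m) (by positivity)
  obtain ⟨φ, hφ, hφz⟩ := extraction_forall_of_eventually
    (P := fun m k => ∀ n ≥ k, x n ∈ prConv 𝕜 r (z m)) fun m => by
      filter_upwards [eventually_ge_atTop (N m)] with k hk n hn
      exact hN m n (hk.trans hn)
  obtain ⟨e, he⟩ := exists_injective_nat (Fin (φ 0) ⊕ Σ _ : ℕ, ℕ)
  -- The finitely many terms before `φ 0` lie in no block and are adjoined as vectors themselves.
  let y : (Fin (φ 0) ⊕ Σ _ : ℕ, ℕ) → X :=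
    Sum.elim (fun j => x j) fun q => (((2 : ℝ) ^ q.1 : ℝ) : 𝕜) • z q.1 q.2
  have hy : countNorm p (fun k => ‖Function.extend e y 0 k‖ₑ) ≠ ∞ := by
    rw [countNorm_enorm_extend hp0 he]
    have h1 : (fun i => ‖y i‖ₑ) = Sum.elim (fun j : Fin (φ 0) => ‖x j‖ₑ)
        fun q => ‖(((2 : ℝ) ^ q.1 : ℝ) : 𝕜) • z q.1 q.2‖ₑ := by
      ext (i | i) <;> rfl
    rw [h1]
    refine ne_top_of_le_ne_top (ENNReal.add_ne_top.2 ⟨?_, ?_⟩) (countNorm_sum_elim_le hp _ _)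
    · refine ne_top_of_le_ne_top ?_ (countNorm_le_tsum hp _)
      rw [tsum_fintype]
      exact (ENNReal.sum_lt_top.2 fun _ _ => enorm_lt_top).ne
    · rw [countNorm_sigma hp0]
      refine ne_top_of_le_ne_top ?_ (countNorm_le_tsum hp _)
      have h2 : ∀ m, countNorm p (fun k => ‖(((2 : ℝ) ^ m : ℝ) : 𝕜) • z m k‖ₑ) ≤
          ENNReal.ofReal ((1 / 2) ^ m) := fun m => by
        simp only [enorm_smul, enorm_rclike_ofReal (show (0 : ℝ) ≤ 2 ^ m by positivity)]
        rw [countNorm_const_mul hp0, ← seqNorm_eq_countNorm]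
        refine (mul_le_mul_right (hz m) _).trans_eq ?_
        rw [← ENNReal.ofReal_mul (by positivity), ← mul_pow]
        norm_num
      refine ne_top_of_le_ne_top ?_ (ENNReal.tsum_le_tsum h2)
      rw [← ENNReal.ofReal_tsum_of_nonneg (fun m => by positivity) summable_geometric_two]
      exact ENNReal.ofReal_ne_top
  obtain ⟨Z, i₁, i₂, i₃, S, hS, hSv⟩ := exists_integral_of_countNorm (𝕜 := 𝕜) hp hp_top hr hrp hy
  have hpre : ∀ n, ∃ v : Z, x n = S v ∧ ∀ m, φ m ≤ n → ‖v‖ ≤ (1 / 2) ^ m := fun n => by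
    rcases lt_or_ge n (φ 0) with hn | hn
    · have he' : Function.Injective fun _ : Unit => e (Sum.inl ⟨n, hn⟩) := fun _ _ _ => rfl
      obtain ⟨v, -, hv⟩ := hSv
        (Function.extend (fun _ : Unit => e (Sum.inl ⟨n, hn⟩)) (1 : Unit → 𝕜) 0) (x n)
        (by
          rw [countNorm_enorm_extend hr0 he']
          exact (countNorm_le_tsum hr _).trans (by simp))
        (by
          rw [hasSum_extend_smul_iff (𝕜 := 𝕜) he']
          simp [he.extend_apply, y])
      exact ⟨v, hv.symm, fun m hm =>
        absurd ((hφ.monotone (Nat.zero_le m)).trans hm) (not_le.2 hn)⟩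
    · obtain ⟨m, hm, hm'⟩ := exists_block hφ hn
      obtain ⟨a, ha, -, hax⟩ := hφz m n hm
      rw [seqNorm_eq_countNorm] at ha
      have he' : Function.Injective fun k : ℕ => e (Sum.inr ⟨m, k⟩) :=
        he.comp (Sum.inr_injective.comp sigma_mk_injective)
      obtain ⟨v, hv1, hv⟩ := hSv (Function.extend (fun k : ℕ => e (Sum.inr ⟨m, k⟩)) a 0)
        ((((2 : ℝ) ^ m : ℝ) : 𝕜) • x n)
        (by rwa [countNorm_enorm_extend hr0 he'])
        (by
          rw [hasSum_extend_smul_iff (𝕜 := 𝕜) he']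
          convert hax.const_smul (((2 : ℝ) ^ m : ℝ) : 𝕜) using 2 with k
          rw [he.extend_apply]
          exact smul_comm _ _ _)
      have h2 : (((2 : ℝ) ^ m : ℝ) : 𝕜) ≠ 0 := RCLike.ofReal_ne_zero.2 (by positivity)
      refine ⟨(((2 : ℝ) ^ m : ℝ) : 𝕜)⁻¹ • v, ?_, fun m' hm'' => ?_⟩
      · rw [map_smul, hv, inv_smul_smul₀ h2]
      · have h3 : m' ≤ m := Nat.lt_succ_iff.1 (hφ.lt_iff_lt.1 (hm''.trans_lt hm'))
        rw [norm_smul, norm_inv, RCLike.norm_ofReal, abs_of_pos (by positivity), one_div, inv_pow]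
        calc _ ≤ ((2 : ℝ) ^ m)⁻¹ * 1 := by gcongr
          _ ≤ _ := by
            rw [mul_one]
            gcongr
            norm_num
  choose v hv hvn using hpre
  refine ⟨Z, i₁, i₂, i₃, v, S, ?_, hS, hv⟩
  rw [Metric.tendsto_atTop]
  intro ε hε
  obtain ⟨m, hm⟩ := exists_pow_lt_of_lt_one hε (show (1 / 2 : ℝ) < 1 by norm_num)
  exact ⟨φ m, fun n hn => by simpa using (hvn n m hn).trans_lt hm⟩

/-! ### Surjective hulls: lifting and passing to quotients -/

theorem subset_surHull (A : OperatorClass.{u} 𝕜) (Y X : Type u) [NormedAddCommGroup Y]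
    [NormedSpace 𝕜 Y] [CompleteSpace Y] [NormedAddCommGroup X] [NormedSpace 𝕜 X]
    [CompleteSpace X] : A Y X ⊆ surHull A Y X := fun _ hT =>
  ⟨Y, inferInstance, inferInstance, inferInstance, .id 𝕜 Y, Function.surjective_id, hT⟩

/-- Sequences that are null for the surjective hull of an operator class are null for the class. -/
theorem IsOpNull.of_surHull {A : OperatorClass.{u} 𝕜} {X : Type u} [NormedAddCommGroup X]
    [NormedSpace 𝕜 X] [CompleteSpace X] {x : ℕ → X} (hx : IsOpNull (surHull A) x) :
    IsOpNull A x := by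
  obtain ⟨Y, _, _, _, y, T, hy, ⟨Z, i₁, i₂, i₃, q, hq, hTq⟩, hxy⟩ := hx
  obtain ⟨C, hC, hpre⟩ := q.exists_preimage_norm_le hq
  choose w hw hwn using fun n => hpre (y n)
  refine ⟨Z, i₁, i₂, i₃, w, T.comp q, ?_, hTq, fun n => by simp [hw, hxy]⟩
  have h1 := hy.norm.const_mul C
  rw [norm_zero, mul_zero] at h1
  exact squeeze_zero_norm hwn h1

theorem IsOpNull.tendsto_and_isOpCompact {A : OperatorClass.{u} 𝕜} {X : Type u}
    [NormedAddCommGroup X] [NormedSpace 𝕜 X] [CompleteSpace X] {x : ℕ → X} (hx : IsOpNull A x) :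
    Tendsto x atTop (𝓝 0) ∧ IsOpCompact A (Set.range x) := by
  obtain ⟨Y, i₁, i₂, i₃, y, T, hy, hT, hxy⟩ := hx
  refine ⟨?_, Y, i₁, i₂, i₃, Set.range y, T, ?_, hT, ?_⟩
  · have h1 := (T.continuous.tendsto 0).comp hy
    rw [map_zero] at h1
    exact h1.congr fun n => (hxy n).symm
  · have hc := hy.isCompact_insert_range
    exact hc.of_isClosed_subset isClosed_closure
      (closure_minimal (Set.subset_insert _ _) hc.isClosed)
  · rintro _ ⟨n, rfl⟩
    exact ⟨y n, Set.mem_range_self n, (hxy n).symm⟩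

/-- A norm-null sequence that is compact for the surjective hull of an operator class is null for
it: after dividing by the kernel, the operator is injective on a compact set. -/
theorem IsOpCompact.isOpNull_surHull {A : OperatorClass.{u} 𝕜} {X : Type u}
    [NormedAddCommGroup X] [NormedSpace 𝕜 X] [CompleteSpace X] {x : ℕ → X}
    (hx : Tendsto x atTop (𝓝 0)) (hK : IsOpCompact (surHull A) (Set.range x)) :
    IsOpNull (surHull A) x := by
  obtain ⟨Y, _, _, _, F, T, hF, ⟨Z, i₁, i₂, i₃, q, hq, hTq⟩, hxF⟩ := hK
  choose y hyF hyx using fun n => hxF (Set.mem_range_self n)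
  let M : Submodule 𝕜 Y := LinearMap.ker (T : Y →ₗ[𝕜] X)
  have : IsClosed (M : Set Y) := T.isClosed_ker
  let T' : Y ⧸ M →L[𝕜] X := M.liftQL T le_rfl
  have hT' : ∀ v, T' (M.mkQL v) = T v := fun v => rfl
  have hker : ∀ v, T' v = 0 → v = 0 := fun v hv => by
    obtain ⟨m, rfl⟩ := M.mkQ_surjective v
    exact (Submodule.Quotient.mk_eq_zero M).2 hv
  -- `T'` stays in the hull: composed with the surjection `M.mkQL.comp q` it is `T.comp q`.
  refine ⟨Y ⧸ M, inferInstance, inferInstance, inferInstance, fun n => M.mkQL (y n), T', ?_,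
    ⟨Z, i₁, i₂, i₃, M.mkQL.comp q, M.mkQ_surjective.comp hq, hTq⟩, fun n => (hyx n).symm⟩
  -- In a compact set it suffices that `0` is the only cluster point; `T'` sends a cluster point to
  -- one of `x`, which is `0`.
  refine (hF.image M.mkQL.continuous).tendsto_nhds_of_unique_mapClusterPt
    (Eventually.of_forall fun n => Set.mem_image_of_mem _ (subset_closure (hyF n))) ?_
  intro v _ hv
  have h1 : MapClusterPt (T' v) atTop x := by
    convert hv.tendsto_comp T'.continuous.continuousAt using 1
    exact funext fun n => (hyx n).symm
  have h2 : (𝓝 (T' v) ⊓ 𝓝 0).NeBot := ClusterPt.mono h1 hx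
  exact hker v (eq_of_nhds_neBot h2)

end PRNull

theorem proposition3p3 {𝕜 : Type} [RCLike 𝕜] (p r : ℝ≥0∞) (hp : 1 ≤ p) (hp_top : p < ∞)
    (hr : 1 ≤ r) (hrp : r ≤ ENNReal.conjExponent p)
    {X : Type u} [NormedAddCommGroup X] [NormedSpace 𝕜 X] [CompleteSpace X] (x : ℕ → X) :
    List.TFAE [
      PRNull.IsPRNull 𝕜 p r x,
      Tendsto x atTop (𝓝 0) ∧ PRNull.IsOpCompact
        (PRNull.surHull (PRNull.integralOperators.{u} 𝕜 p 1 (ENNReal.conjExponent r)))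
        (Set.range x),
      PRNull.IsOpNull
        (PRNull.surHull (PRNull.integralOperators.{u} 𝕜 p 1 (ENNReal.conjExponent r))) x] := by
  tfae_have 1 → 3 := fun h => by
    obtain ⟨Y, i₁, i₂, i₃, y, T, hy, hT, hxy⟩ := PRNull.isOpNull_of_isPRNull hp hp_top hr hrp h
    exact ⟨Y, i₁, i₂, i₃, y, T, hy, PRNull.subset_surHull _ Y X hT, hxy⟩
  tfae_have 3 → 2 := PRNull.IsOpNull.tendsto_and_isOpCompact
  tfae_have 2 → 3 := fun h => PRNull.IsOpCompact.isOpNull_surHull h.1 h.2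
  tfae_have 3 → 1 := fun h => by
    obtain ⟨Z, _, _, _, w, S, hw, hS, hxw⟩ := h.of_surHull
    rw [funext hxw]
    exact PRNull.isPRNull_of_integral hp hr hrp hS hw
  tfae_finish
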